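/- Let $n\ge 0$ and $\mathfrak g=\mathfrak{gl}(n,\mathbb C)$. For $x\in\mathfrak g$ and $1\le i\le n$ let $x_i$ denote the upper left $i\times i$ corner of $x$, and for $1\le j\le i\le n$ let $f_{i,j}:\mathfrak g\to\mathbb C$ be the function $f_{i,j}(x)=\operatorname{tr}(x_i^{\,j})$. An element $x\in\mathfrak g$ is called strongly regular if the $\binom{n+1}{2}$ differentials $(df_{i,j})_x$, $1\le j\le i\le n$, are linearly independent over $\mathbb C$. A Borel subalgebra of $\mathfrak g$ is a maximal solvable Lie subalgebra of $\mathfrak g$. Theorem. Every Borel subalgebra $\mathfrak b\subset\mathfrak g$ contains a strongly regular element. -/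

import Mathlib

attribute [local instance 100] LieRing.ofAssociativeRing

namespace GelfandZeitlin

/-- The upper left `i × i` corner of an `n × n` matrix, where `i ≤ n`. -/
def corner {n : ℕ} (i : ℕ) (hi : i ≤ n) (x : Matrix (Fin n) (Fin n) ℂ) :
    Matrix (Fin i) (Fin i) ℂ :=
  x.submatrix (Fin.castLE hi) (Fin.castLE hi)

/-- Index set of the Gelfand-Zeitlin functions. The element `⟨i, j⟩` stands for the pair
`(i + 1, j + 1)`, so that the pairs `(i, j)` with `1 ≤ i ≤ n`, `1 ≤ j ≤ i` are enumerated. -/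
abbrev Index (n : ℕ) : Type := Σ i : Fin n, Fin (i.val + 1)

/-- The Gelfand-Zeitlin functions: the trace of the `j`-th power of the upper left
`i × i` corner, for `1 ≤ i ≤ n` and `1 ≤ j ≤ i`. -/
def gzFun {n : ℕ} (p : Index n) (x : Matrix (Fin n) (Fin n) ℂ) : ℂ :=
  ((corner (p.1.val + 1) p.1.isLt x) ^ (p.2.val + 1)).trace

/-- A matrix is strongly regular if the (complex) differentials at `x` of all the
Gelfand-Zeitlin functions are linearly independent. -/
def IsStronglyRegular {n : ℕ} (x : Matrix (Fin n) (Fin n) ℂ) : Prop :=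
  LinearIndependent ℂ (fun p : Index n => fderiv ℂ (gzFun p) x)

/-- A Borel subalgebra of a Lie algebra is a maximal solvable Lie subalgebra. -/
def IsBorel {L : Type*} [LieRing L] [LieAlgebra ℂ L] (b : LieSubalgebra ℂ L) : Prop :=
  Maximal (fun s : LieSubalgebra ℂ L => LieAlgebra.IsSolvable s) b

end GelfandZeitlin

namespace GelfandZeitlin

open Matrix Module

/-! By Lie's theorem a Borel subalgebra is the stabilizer `conjUpper A` of a full flag, and one
inducts on the matrix size. By `isStronglyRegular_of_corner`, a matrix `x` of size `n + 1` is
strongly regular if its `n × n` corner is and if no nonzero polynomial of degree at most `n` in `x`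
has zero last row and column.

Each condition holds somewhere in the subalgebra. Choose a basis adapted to the flag with only one
vector outside `ℂ ^ n`. Then the corners include a flag stabilizer of `ℂ ^ n` (`exists_corner_eq`),
so induction gives the first condition. A further change of adapted basis makes, for each index, the
eigenvector or the dual eigenvector see the last coordinate, and distinct eigenvalues give the
second (`exists_linearIndependent_lastColRow`).

On the complex line joining the two elements, each condition is implied by the nonvanishing of an
entire function that is not identically zero, so some point satisfies both. -/

/-! ### Borel subalgebras are flag stabilizers -/

/-- **Lie's theorem**, flag version: a finite-dimensional module over a solvable Lie algebra has a
basis in which the algebra acts by upper triangular matrices. -/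
theorem exists_triangularizing_family {L : Type*} [LieRing L] [LieAlgebra ℂ L]
    [LieAlgebra.IsSolvable L] (n : ℕ) (V : Type*) [AddCommGroup V] [Module ℂ V]
    [LieRingModule L V] [LieModule ℂ L V] [FiniteDimensional ℂ V] (hn : finrank ℂ V = n) :
    ∃ v : Fin n → V, LinearIndependent ℂ v ∧ ∀ (x : L) (j : Fin n), ∃ t : Fin n → ℂ,
      (∀ i, j < i → t i = 0) ∧ ⁅x, v j⁆ = ∑ i, t i • v i := by
  induction n generalizing V with
  | zero => exact ⟨Fin.elim0, linearIndependent_empty_type, fun _ j => j.elim0⟩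
  | succ n ih =>
    have : Nontrivial V := nontrivial_of_finrank_pos (R := ℂ) (by omega)
    obtain ⟨χ, hχ⟩ := LieModule.exists_nontrivial_weightSpace_of_isSolvable ℂ L V
    obtain ⟨⟨e, he⟩, he0⟩ := exists_ne (0 : LieModule.weightSpace V χ)
    rw [LieModule.mem_weightSpace] at he
    replace he0 : e ≠ 0 := fun h => he0 (by simp [h])
    -- The common eigenvector spans an invariant line; a triangularizing basis of the quotient is
    -- lifted and `e` put in front.
    let N : LieSubmodule ℂ L V :=
      { toSubmodule := ℂ ∙ e
        lie_mem := by
          intro x m hm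
          obtain ⟨c, rfl⟩ := Submodule.mem_span_singleton.1 hm
          rw [lie_smul, he, smul_comm]
          exact Submodule.smul_mem _ _ hm }
    have hN : ∀ m, m ∈ N ↔ ∃ c : ℂ, c • e = m := fun m => Submodule.mem_span_singleton
    have hfr : finrank ℂ (V ⧸ N) = n := by
      have h1 := Submodule.finrank_quotient_add_finrank (ℂ ∙ e)
      rw [finrank_span_singleton he0, hn] at h1
      exact Nat.add_right_cancel h1
    obtain ⟨w, hw, hwt⟩ := ih (V ⧸ N) hfr
    choose u hu using fun i => LieSubmodule.Quotient.surjective_mk' N (w i)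
    refine ⟨Fin.cons e u, ?_, ?_⟩
    · rw [Fintype.linearIndependent_iff] at hw ⊢
      intro g hg
      rw [Fin.sum_univ_succ] at hg
      simp only [Fin.cons_zero, Fin.cons_succ] at hg
      have h0 : (LieSubmodule.Quotient.mk' N) e = 0 :=
        (LieSubmodule.Quotient.mk_eq_zero N).2 ((hN e).2 ⟨1, one_smul _ _⟩)
      have h1 := congrArg (LieSubmodule.Quotient.mk' N) hg
      simp only [map_add, map_smul, map_sum, h0, hu, smul_zero, zero_add, map_zero] at h1
      have h2 := hw _ h1
      simp only [h2, zero_smul, Finset.sum_const_zero, add_zero] at hg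
      intro i
      refine Fin.cases ?_ h2 i
      exact (smul_eq_zero.1 hg).resolve_right he0
    · intro x j
      refine Fin.cases ?_ (fun j => ?_) j
      · refine ⟨Pi.single 0 (χ x), fun i hi => Pi.single_eq_of_ne hi.ne' _, ?_⟩
        rw [Fin.sum_univ_succ]
        simp [he]
      · obtain ⟨t, ht, hxt⟩ := hwt x j
        have hmem : ⁅x, u j⁆ - ∑ i, t i • u i ∈ N := by
          rw [← LieSubmodule.Quotient.mk_eq_zero]
          simp only [map_sub, map_sum, map_smul, LieModuleHom.map_lie, hu, hxt, sub_self]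
        obtain ⟨c, hc⟩ := (hN _).1 hmem
        refine ⟨Fin.cons c t, fun i => ?_, ?_⟩
        · refine Fin.cases (fun h => absurd h (Fin.not_lt_zero _)) (fun i h => ?_) i
          exact ht i (Fin.succ_lt_succ_iff.1 h)
        · rw [Fin.sum_univ_succ]
          simp only [Fin.cons_zero, Fin.cons_succ, hc, sub_add_cancel]

/-- The Lie subalgebra of matrices that become upper triangular after conjugation by `A`. -/
def conjUpper {n : ℕ} (A : (Matrix (Fin n) (Fin n) ℂ)ˣ) :
    LieSubalgebra ℂ (Matrix (Fin n) (Fin n) ℂ) where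
  carrier := {x | (A⁻¹.val * x * A.val).IsUpperTriangular}
  add_mem' {x y} hx hy := by
    simpa only [Set.mem_ofPred_eq, mul_add, add_mul] using BlockTriangular.add hx hy
  zero_mem' := by simp [IsUpperTriangular]
  smul_mem' c x hx := by
    intro i j hij
    have := hx hij
    simp only [Matrix.mul_smul, Matrix.smul_mul, Matrix.smul_apply, this, smul_zero]
  lie_mem' {x y} hx hy := by
    have key : A⁻¹.val * ⁅x, y⁆ * A.val = (A⁻¹.val * x * A.val) * (A⁻¹.val * y * A.val)
        - (A⁻¹.val * y * A.val) * (A⁻¹.val * x * A.val) := by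
      simp only [Ring.lie_def, mul_sub, sub_mul, mul_assoc, Units.mul_inv_cancel_left]
    change (A⁻¹.val * ⁅x, y⁆ * A.val).IsUpperTriangular
    rw [key]
    exact (BlockTriangular.mul hx hy).sub (BlockTriangular.mul hy hx)

theorem mem_conjUpper {n : ℕ} {A : (Matrix (Fin n) (Fin n) ℂ)ˣ} {x : Matrix (Fin n) (Fin n) ℂ} :
    x ∈ conjUpper A ↔ (A⁻¹.val * x * A.val).IsUpperTriangular := Iff.rfl

/-- Every solvable subalgebra of `gl(n)` is contained in the stabilizer of a full flag. -/
theorem exists_le_conjUpper {n : ℕ} (b : LieSubalgebra ℂ (Matrix (Fin n) (Fin n) ℂ))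
    (hb : LieAlgebra.IsSolvable b) : ∃ A, b ≤ conjUpper A := by
  let φ : b →ₗ⁅ℂ⁆ Module.End ℂ (Fin n → ℂ) :=
    (lieEquivMatrix' (R := ℂ) (n := Fin n)).symm.toLieHom.comp b.incl
  let : LieRingModule b (Fin n → ℂ) := LieRingModule.compLieHom _ φ
  let : LieModule ℂ b (Fin n → ℂ) := LieModule.compLieHom _ φ
  obtain ⟨v, hv, ht⟩ := exists_triangularizing_family (L := b) n (Fin n → ℂ) (by simp)
  have hφ : ∀ (x : b) (w : Fin n → ℂ), φ x w = x.1 *ᵥ w := fun x w => by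
    simp [φ]
  choose t ht0 ht using ht
  have hunit : IsUnit (Matrix.of v)ᵀ := by
    rw [isUnit_transpose, ← linearIndependent_rows_iff_isUnit]
    exact hv
  obtain ⟨A, hA⟩ := hunit
  refine ⟨A, fun x hx => ?_⟩
  have hmul : x * A.val = A.val * Matrix.of (fun i j => t ⟨x, hx⟩ j i) := by
    ext i j
    have h1 := congrFun (ht ⟨x, hx⟩ j) i
    change φ ⟨x, hx⟩ (v j) i = _ at h1
    rw [hφ] at h1
    rw [hA]
    simp only [mulVec, dotProduct, Finset.sum_apply, Pi.smul_apply, smul_eq_mul] at h1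
    simp only [mul_apply, transpose_apply, of_apply]
    rw [h1]
    exact Finset.sum_congr rfl fun _ _ => mul_comm _ _
  rw [mem_conjUpper, mul_assoc, hmul, Units.inv_mul_cancel_left]
  intro i j hij
  exact ht0 ⟨x, hx⟩ j i hij

/-- Matrices supported on and above the `k`-th superdiagonal. -/
def IsAboveDiagonal {n : ℕ} (k : ℕ) (T : Matrix (Fin n) (Fin n) ℂ) : Prop :=
  ∀ i j : Fin n, j.val < i.val + k → T i j = 0

/-- For `k ≥ 1` products already move up by `2 * k ≥ k + 1`. For `k = 0` only the diagonal products
survive, and they cancel in the commutator. -/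
theorem IsAboveDiagonal.commutator {n k : ℕ} {S T : Matrix (Fin n) (Fin n) ℂ}
    (hS : IsAboveDiagonal k S) (hT : IsAboveDiagonal k T) :
    IsAboveDiagonal (k + 1) (S * T - T * S) := by
  intro i j hij
  rw [Matrix.sub_apply, mul_apply, mul_apply, ← Finset.sum_sub_distrib]
  refine Finset.sum_eq_zero fun l _ => ?_
  by_cases h : l = i ∧ l = j
  · rw [← h.1, ← h.2, mul_comm, sub_self]
  · have aux : ∀ {S T : Matrix (Fin n) (Fin n) ℂ}, IsAboveDiagonal k S → IsAboveDiagonal k T →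
        S i l * T l j = 0 := by
      intro S T hS hT
      by_cases h1 : l.val < i.val + k
      · rw [hS _ _ h1, zero_mul]
      · rw [hT l j ?_, mul_zero]
        rcases Nat.eq_zero_or_pos k with rfl | hk
        · by_contra h2
          exact h ⟨Fin.ext (by omega), Fin.ext (by omega)⟩
        · omega
    rw [aux hS hT, aux hT hS, sub_zero]

/-- After conjugation, the `k`-th derived algebra lies on and above the `k`-th superdiagonal, so the
`n`-th is zero. -/
theorem isSolvable_conjUpper {n : ℕ} (A : (Matrix (Fin n) (Fin n) ℂ)ˣ) :
    LieAlgebra.IsSolvable (conjUpper A) := by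
  have key : ∀ k, ∀ x ∈ LieAlgebra.derivedSeries ℂ (conjUpper A) k,
      IsAboveDiagonal k (A⁻¹.val * x.1 * A.val) := by
    intro k
    induction k with
    | zero =>
      intro x _ i j hij
      exact x.2 (show j < i from hij)
    | succ k ih =>
      intro x hx
      rw [LieAlgebra.derivedSeries_def, LieAlgebra.derivedSeriesOfIdeal_succ,
        ← LieSubmodule.mem_toSubmodule, LieSubmodule.lieIdeal_oper_eq_linear_span'] at hx
      induction hx using Submodule.span_induction with
      | mem x hx =>
        obtain ⟨y, hy, z, hz, rfl⟩ := hx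
        have h := (ih y hy).commutator (ih z hz)
        rwa [show A⁻¹.val * (⁅y, z⁆ : conjUpper A).1 * A.val =
          (A⁻¹.val * y.1 * A.val) * (A⁻¹.val * z.1 * A.val)
          - (A⁻¹.val * z.1 * A.val) * (A⁻¹.val * y.1 * A.val) by
            simp only [LieSubalgebra.coe_bracket, Ring.lie_def, mul_sub, sub_mul, mul_assoc,
              Units.mul_inv_cancel_left]]
      | zero => intro i j _; simp
      | add x y _ _ hx hy =>
        intro i j hij
        have h1 := hx i j hij
        have h2 := hy i j hij
        rw [show (x + y).1 = x.1 + y.1 from rfl]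
        simp only [mul_add, add_mul, Matrix.add_apply, h1, h2, add_zero]
      | smul c x _ hx =>
        intro i j hij
        have h1 := hx i j hij
        rw [show (c • x).1 = c • x.1 from rfl]
        simp only [Matrix.mul_smul, Matrix.smul_mul, Matrix.smul_apply, h1, smul_zero]
  refine LieAlgebra.IsSolvable.mk (R := ℂ) (k := n) ((LieSubmodule.eq_bot_iff _).2 fun x hx => ?_)
  have h0 : A⁻¹.val * x.1 * A.val = 0 := by
    ext i j
    exact key n x hx i j (by omega)
  apply Subtype.ext
  have h1 : x.1 = A.val * (A⁻¹.val * x.1 * A.val) * A⁻¹.val := by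
    simp only [mul_assoc, Units.mul_inv_cancel_left, Units.mul_inv, mul_one]
  rw [h1, h0]
  simp

theorem IsBorel.exists_eq_conjUpper {n : ℕ} {b : LieSubalgebra ℂ (Matrix (Fin n) (Fin n) ℂ)}
    (hb : IsBorel b) : ∃ A, b = conjUpper A := by
  obtain ⟨A, hA⟩ := exists_le_conjUpper b hb.1
  exact ⟨A, le_antisymm hA (hb.2 (isSolvable_conjUpper A) hA)⟩

/-! ### Differentials of the Gelfand-Zeitlin functions -/

/-- The corner map as a linear map. -/
def cornerLin {n : ℕ} (i : ℕ) (hi : i ≤ n) :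
    Matrix (Fin n) (Fin n) ℂ →ₗ[ℂ] Matrix (Fin i) (Fin i) ℂ where
  toFun := corner i hi
  map_add' _ _ := rfl
  map_smul' _ _ := rfl

/-- The differential of a Gelfand-Zeitlin function, up to a nonzero scalar. -/
def gzDiff {n : ℕ} (x : Matrix (Fin n) (Fin n) ℂ) (p : Index n) :
    Dual ℂ (Matrix (Fin n) (Fin n) ℂ) :=
  traceLinearMap (Fin (p.1.val + 1)) ℂ ℂ ∘ₗ
    LinearMap.mulLeft ℂ (corner (p.1.val + 1) p.1.isLt x ^ p.2.val) ∘ₗ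
      cornerLin (p.1.val + 1) p.1.isLt

theorem gzDiff_apply {n : ℕ} (x y : Matrix (Fin n) (Fin n) ℂ) (p : Index n) :
    gzDiff x p y = (corner (p.1.val + 1) p.1.isLt x ^ p.2.val *
      corner (p.1.val + 1) p.1.isLt y).trace := rfl

section Norm

attribute [local instance] Matrix.linftyOpNormedRing Matrix.linftyOpNormedAlgebra

theorem hasFDerivAt_trace_pow {n : ℕ} (k : ℕ) (x : Matrix (Fin n) (Fin n) ℂ) :
    HasFDerivAt (𝕜 := ℂ) (fun y : Matrix (Fin n) (Fin n) ℂ => (y ^ (k + 1)).trace)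
      (LinearMap.toContinuousLinearMap (((k : ℂ) + 1) •
        (traceLinearMap (Fin n) ℂ ℂ ∘ₗ LinearMap.mulLeft ℂ (x ^ k)))) x := by
  have h := hasFDerivAt_pow' (𝕜 := ℂ) (𝔸 := Matrix (Fin n) (Fin n) ℂ) (k + 1) (x := x)
  have h2 := ((traceLinearMap (Fin n) ℂ ℂ).toContinuousLinearMap.hasFDerivAt
    (x := x ^ (k + 1))).comp x h
  refine h2.congr_fderiv ?_
  ext y
  -- Cyclicity of the trace makes all `k + 1` terms of the noncommutative power rule equal.
  have h3 : ∀ i ∈ Finset.range (k + 1), (x ^ (k - i) * y * x ^ i).trace = (x ^ k * y).trace := by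
    intro i hi
    rw [trace_mul_comm, ← mul_assoc, ← pow_add, 
      Nat.add_sub_cancel' (Nat.lt_succ_iff.1 (Finset.mem_range.1 hi))]
  have h4 := Finset.sum_congr rfl h3
  rw [Finset.sum_const, Finset.card_range, nsmul_eq_mul, Nat.cast_add_one, ← trace_sum] at h4
  have h5 : (∑ i ∈ Finset.range (k + 1), MulOpposite.op (x ^ i) • x ^ ((k + 1).pred - i) •
      ContinuousLinearMap.id ℂ (Matrix (Fin n) (Fin n) ℂ)) y =
      ∑ i ∈ Finset.range (k + 1), x ^ (k - i) * y * x ^ i := by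
    rw [_root_.sum_apply]
    rfl
  exact (congrArg trace h5).trans h4

theorem fderiv_gzFun {n : ℕ} (x : Matrix (Fin n) (Fin n) ℂ) (p : Index n) :
    fderiv ℂ (gzFun p) x = ((p.2.val : ℂ) + 1) • LinearMap.toContinuousLinearMap (gzDiff x p) := by
  have h := (hasFDerivAt_trace_pow p.2.val (corner (p.1.val + 1) p.1.isLt x)).comp x
    (cornerLin (p.1.val + 1) p.1.isLt).toContinuousLinearMap.hasFDerivAt
  exact h.fderiv

theorem differentiable_gzDiff_line {n : ℕ} (a d : Matrix (Fin n) (Fin n) ℂ) (p : Index n)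
    (y : Matrix (Fin n) (Fin n) ℂ) :
    Differentiable ℂ (fun t : ℂ => gzDiff (a + t • d) p y) := by
  have h1 : Differentiable ℂ (fun t : ℂ => cornerLin (p.1.val + 1) p.1.isLt (a + t • d)) := by
    simp only [map_add, map_smul]
    fun_prop
  exact (traceLinearMap (Fin (p.1.val + 1)) ℂ ℂ).toContinuousLinearMap.differentiable.comp
    ((h1.pow p.2.val).mul_const (corner (p.1.val + 1) p.1.isLt y))

theorem differentiable_apply_pow_line {n : ℕ} (a d : Matrix (Fin n) (Fin n) ℂ) (k : ℕ)
    (φ : Matrix (Fin n) (Fin n) ℂ →ₗ[ℂ] ℂ) :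
    Differentiable ℂ (fun t : ℂ => φ ((a + t • d) ^ k)) := by
  have h1 : Differentiable ℂ (fun t : ℂ => a + t • d) := by fun_prop
  exact φ.toContinuousLinearMap.differentiable.comp (h1.pow k)

end Norm

theorem isStronglyRegular_iff {n : ℕ} {x : Matrix (Fin n) (Fin n) ℂ} :
    IsStronglyRegular x ↔ LinearIndependent ℂ (gzDiff x) := by
  let w : Index n → ℂˣ := fun p =>
    Units.mk0 ((p.2.val : ℂ) + 1) (Nat.cast_add_one_ne_zero _)
  let e := LinearMap.toContinuousLinearMap (𝕜 := ℂ) (E := Matrix (Fin n) (Fin n) ℂ) (F' := ℂ)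
  have h : (fun p : Index n => fderiv ℂ (gzFun p) x) =
      fun p => w p • e.toLinearMap (gzDiff x p) := funext (fderiv_gzFun x)
  rw [IsStronglyRegular, h]
  exact (LinearIndependent.units_smul_iff (e.toLinearMap ∘ gzDiff x) w).trans
    (LinearMap.linearIndependent_iff _ (LinearEquiv.ker _))

/-! ### Genericity along a complex line -/

/-- Linear independence of a family of vectors depending holomorphically on a parameter is
detected by the nonvanishing of an entire function. -/
theorem exists_differentiable_detecting_linearIndependent {ι W : Type*} [Fintype ι]
    [DecidableEq ι] [AddCommGroup W] [Module ℂ W] (f : ℂ → ι → W)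
    (hf : ∀ (φ : Dual ℂ W) (i : ι), Differentiable ℂ (fun t => φ (f t i)))
    (t₀ : ℂ) (h₀ : LinearIndependent ℂ (f t₀)) :
    ∃ g : ℂ → ℂ, Differentiable ℂ g ∧ g t₀ ≠ 0 ∧ ∀ t, g t ≠ 0 → LinearIndependent ℂ (f t) := by
  -- The coordinates `l` are chosen so that the matrix of `f t₀` is the identity; its determinant is
  -- the detecting function.
  obtain ⟨l, hl⟩ := (Fintype.linearCombination ℂ (f t₀)).exists_leftInverse_of_injective
    (LinearMap.ker_eq_bot.2 (linearIndependent_iff_injective_fintypeLinearCombination.1 h₀))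
  let M : ℂ → Matrix ι ι ℂ := fun t => Matrix.of fun i => l (f t i)
  refine ⟨fun t => (M t).det, ?_, ?_, fun t ht => ?_⟩
  · simp only [det_apply]
    refine Differentiable.fun_sum fun σ _ => Differentiable.const_smul ?_ _
    refine Differentiable.fun_finsetProd fun i _ => ?_
    exact hf (LinearMap.proj i ∘ₗ l) (σ i)
  · have : M t₀ = 1 := by
      ext i j
      have h := LinearMap.congr_fun hl (Pi.single i 1)
      simp at h
      simp [M, h, one_apply, Pi.single_apply, eq_comm]
    simp [this]
  · have hu : IsUnit (M t) := (isUnit_iff_isUnit_det _).2 (isUnit_iff_ne_zero.2 ht)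
    exact LinearIndependent.of_comp l (linearIndependent_rows_iff_isUnit.2 hu)

theorem exists_ne_zero_and_ne_zero {g h : ℂ → ℂ} (hg : Differentiable ℂ g)
    (hh : Differentiable ℂ h) {s t : ℂ} (hs : g s ≠ 0) (ht : h t ≠ 0) :
    ∃ z, g z ≠ 0 ∧ h z ≠ 0 := by
  by_contra! hc
  rcases AnalyticOnNhd.eq_zero_or_eq_zero_of_mul_eq_zero (U := Set.univ)
    (fun z _ => hg.analyticAt z) (fun z _ => hh.analyticAt z)
    (fun z _ => mul_eq_zero.2 (or_iff_not_imp_left.2 (hc z))) isPreconnected_univ with h1 | h1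
  · exact hs (h1 s trivial)
  · exact ht (h1 t trivial)

/-! ### Reduction to the maximal proper corner -/

/-- The last rows and columns of the powers `x ^ k`, `k ≤ n`, of a matrix of size `n + 1`. -/
def lastColRow {n : ℕ} (x : Matrix (Fin (n + 1)) (Fin (n + 1)) ℂ) (k : Fin (n + 1)) :
    (Fin (n + 1) → ℂ) × (Fin (n + 1) → ℂ) :=
  ((x ^ k.val).col (Fin.last n), (x ^ k.val).row (Fin.last n))

theorem linearIndependent_lastColRow_iff {n : ℕ} {x : Matrix (Fin (n + 1)) (Fin (n + 1)) ℂ} :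
    LinearIndependent ℂ (lastColRow x) ↔ ∀ c : Fin (n + 1) → ℂ,
      (∀ i, ∑ k, c k * (x ^ k.val) i (Fin.last n) = 0) →
      (∀ i, ∑ k, c k * (x ^ k.val) (Fin.last n) i = 0) → ∀ k, c k = 0 := by
  rw [Fintype.linearIndependent_iff]
  refine forall_congr' fun c => ?_
  rw [Prod.ext_iff, funext_iff, funext_iff, and_imp]
  simp [lastColRow, Prod.fst_sum, Prod.snd_sum]

/-- A matrix is strongly regular if its maximal proper corner is strongly regular and the last
rows and columns of its powers are linearly independent. -/
theorem isStronglyRegular_of_corner {n : ℕ} {x : Matrix (Fin (n + 1)) (Fin (n + 1)) ℂ}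
    (h₁ : IsStronglyRegular (corner n n.le_succ x)) (h₂ : LinearIndependent ℂ (lastColRow x)) :
    IsStronglyRegular x := by
  rw [isStronglyRegular_iff, Fintype.linearIndependent_iff] at h₁ ⊢
  rw [linearIndependent_lastColRow_iff] at h₂
  intro c hc
  have hsum : ∀ y, (∑ i : Fin n, ∑ j : Fin (i.val + 1), c ⟨i.castSucc, j⟩ *
      gzDiff (corner n n.le_succ x) ⟨i, j⟩ (corner n n.le_succ y)) +
      ∑ k : Fin (n + 1), c ⟨Fin.last n, k⟩ * (x ^ k.val * y).trace = 0 := by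
    intro y
    have h := LinearMap.congr_fun hc y
    rw [LinearMap.sum_apply, Fintype.sum_sigma, Fin.sum_univ_castSucc] at h
    exact h
  -- Directions with zero corner isolate the full-size functions; matrix units in the last row or
  -- column then read off the last column or row of `∑ c_k x ^ k`.
  have hzero : ∀ y, corner n n.le_succ y = 0 →
      ∑ k : Fin (n + 1), c ⟨Fin.last n, k⟩ * (x ^ k.val * y).trace = 0 := by
    intro y hy
    have h := hsum y
    simpa only [hy, map_zero, mul_zero, Finset.sum_const_zero, zero_add] using h
  have hlast : ∀ k : Fin (n + 1), c ⟨Fin.last n, k⟩ = 0 := by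
    refine h₂ (fun k => c ⟨Fin.last n, k⟩) (fun i => ?_) (fun i => ?_)
    · have h := hzero (single (Fin.last n) i 1) (by
        ext a b
        exact single_apply_of_row_ne (Fin.castSucc_lt_last a).ne' _ _ _)
      simpa [trace_mul_single] using h
    · have h := hzero (single i (Fin.last n) 1) (by
        ext a b
        exact single_apply_of_col_ne _ _ (Fin.castSucc_lt_last b).ne' _)
      simpa [trace_mul_single] using h
  have hrest := h₁ (fun p => c ⟨p.1.castSucc, p.2⟩) (by
    ext1 y
    obtain ⟨y, rfl⟩ : ∃ z, corner n n.le_succ z = y :=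
      ⟨Matrix.of fun i j => if h : i.val < n ∧ j.val < n then y ⟨i, h.1⟩ ⟨j, h.2⟩ else 0, by
        ext a b
        simp [corner]⟩
    have h := hsum y
    simp only [hlast, zero_mul, Finset.sum_const_zero, add_zero] at h
    rw [LinearMap.sum_apply, Fintype.sum_sigma]
    exact h)
  rintro ⟨i, j⟩
  refine Fin.lastCases (motive := fun i => ∀ j : Fin (i.val + 1), c ⟨i, j⟩ = 0) hlast
    (fun i j => hrest ⟨i, j⟩) i j

/-! ### Adapted bases of the flag -/

/-- The elementary unipotent matrix `1 + u wᵀ`, where `w ⬝ u = 0`. -/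
def unipotent {n : ℕ} (u w : Fin n → ℂ) (h : w ⬝ᵥ u = 0) : (Matrix (Fin n) (Fin n) ℂ)ˣ where
  val := 1 + vecMulVec u w
  inv := 1 - vecMulVec u w
  val_inv := by
    rw [mul_sub, mul_one, add_mul, one_mul, vecMulVec_mul_vecMulVec, h]
    simp
  inv_val := by
    rw [mul_add, mul_one, sub_mul, one_mul, vecMulVec_mul_vecMulVec, h]
    simp

/-- The unipotent factor is upper triangular, so the new basis is adapted to the same flag. -/
theorem conjUpper_mul_unipotent_le {n : ℕ} (A : (Matrix (Fin n) (Fin n) ℂ)ˣ) {u w : Fin n → ℂ}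
    (h : w ⬝ᵥ u = 0) (huw : ∀ i j, j < i → u i * w j = 0) :
    conjUpper (A * unipotent u w h) ≤ conjUpper A := by
  intro x hx
  rw [mem_conjUpper] at hx ⊢
  have hv : (vecMulVec u w).IsUpperTriangular := fun i j hij => huw i j hij
  have hU : (unipotent u w h).val.IsUpperTriangular := blockTriangular_one.add hv
  have hU' : (unipotent u w h)⁻¹.val.IsUpperTriangular := blockTriangular_one.sub hv
  have h1 := (hU.mul hx).mul hU'
  set U := unipotent u w h
  have h2 : A⁻¹.val * x * A.val = U.val * ((A * U)⁻¹.val * x * (A * U).val) * U⁻¹.val := by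
    rw [_root_.mul_inv_rev]
    simp only [Units.val_mul, mul_assoc, Units.mul_inv_cancel_left, Units.mul_inv, mul_one]
  rwa [h2]

/-- The stabilizer of a full flag in `ℂ ^ (n + 1)` is the stabilizer of a full flag with an
adapted basis in which all but one of the vectors lie in the coordinate hyperplane `ℂ ^ n`. -/
theorem exists_conjUpper_le_and_last_row {n : ℕ} (A : (Matrix (Fin (n + 1)) (Fin (n + 1)) ℂ)ˣ) :
    ∃ (B : (Matrix (Fin (n + 1)) (Fin (n + 1)) ℂ)ˣ) (m : Fin (n + 1)),
      conjUpper B ≤ conjUpper A ∧ B.val (Fin.last n) m ≠ 0 ∧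
      ∀ j, j ≠ m → B.val (Fin.last n) j = 0 := by
  classical
  set r := A.val (Fin.last n) with hr
  have hr0 : ∃ j, r j ≠ 0 := by
    by_contra! h
    have h1 := congrFun (congrFun A.mul_inv (Fin.last n)) (Fin.last n)
    rw [mul_apply, one_apply_eq] at h1
    simp [show ∀ j, A.val (Fin.last n) j = 0 from h] at h1
  obtain ⟨m, hm, hmin⟩ : ∃ m, r m ≠ 0 ∧ ∀ j < m, r j = 0 := by
    obtain ⟨m, hm⟩ := WellFounded.has_min (wellFounded_lt (α := Fin (n + 1))) {j | r j ≠ 0} hr0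
    exact ⟨m, hm.1, fun j hj => by_contra fun h => hm.2 j h hj⟩
  -- Column `m` is the first with nonzero last entry; multiples of it clear the last entries of the
  -- later columns.
  let w : Fin (n + 1) → ℂ := fun j => if m < j then -(r j / r m) else 0
  have hw : w ⬝ᵥ Pi.single m 1 = 0 := by simp [w]
  refine ⟨A * unipotent _ w hw, m, conjUpper_mul_unipotent_le A hw fun i j hij => ?_, ?_⟩
  · by_cases him : i = m
    · subst him
      simp [w, hij.not_gt]
    · simp [him]
  · have hrow : ∀ j, (A * unipotent _ w hw).val (Fin.last n) j = r j + r m * w j := by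
      intro j
      simp [unipotent, mul_add, hr, Matrix.add_apply, mul_vecMulVec, vecMulVec_apply]
    refine ⟨by simpa [hrow, w] using hm, fun j hj => ?_⟩
    rw [hrow]
    rcases lt_or_gt_of_ne hj with h | h
    · simp [w, h.not_gt, hmin j h]
    · simp only [w, h, if_true]
      field_simp
      ring

/-- A regular semisimple matrix whose eigenvectors and dual eigenvectors pair nontrivially with
the last coordinate. -/
theorem linearIndependent_lastColRow_of_diagonal {n : ℕ}
    (A : (Matrix (Fin (n + 1)) (Fin (n + 1)) ℂ)ˣ) (d : Fin (n + 1) → ℂ)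
    (hd : Function.Injective d)
    (h : ∀ j, A⁻¹.val j (Fin.last n) ≠ 0 ∨ A.val (Fin.last n) j ≠ 0) :
    LinearIndependent ℂ (lastColRow (A.val * diagonal d * A⁻¹.val)) := by
  rw [linearIndependent_lastColRow_iff]
  intro c hcol hrow
  have hpow : ∀ k : ℕ, (A.val * diagonal d * A⁻¹.val) ^ k =
      A.val * diagonal (fun j => d j ^ k) * A⁻¹.val := by
    intro k
    rw [Units.conj_pow, diagonal_pow]
    rfl
  have hsum : ∑ k : Fin (n + 1), c k • (A.val * diagonal d * A⁻¹.val) ^ k.val =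
      A.val * diagonal (fun j => ∑ k, c k * d j ^ k.val) * A⁻¹.val := by
    have h1 : diagonal (fun j => ∑ k, c k * d j ^ k.val) =
        ∑ k : Fin (n + 1), c k • diagonal (fun j => d j ^ k.val) := by
      ext i j
      by_cases hij : i = j
      · subst hij; simp [Matrix.sum_apply]
      · simp [Matrix.sum_apply, hij]
    rw [h1, Finset.mul_sum, Finset.sum_mul]
    simp only [hpow, Matrix.mul_smul, Matrix.smul_mul]
  set x := A.val * diagonal d * A⁻¹.val
  set p : Fin (n + 1) → ℂ := fun j => ∑ k, c k * d j ^ k.val with hp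
  have hp0 : ∀ j, p j = 0 := by
    intro j
    rcases h j with hj | hj
    · have h1 : A⁻¹.val * (∑ k : Fin (n + 1), c k • x ^ k.val) = diagonal p * A⁻¹.val := by
        rw [hsum, mul_assoc, Units.inv_mul_cancel_left]
      have h2 := congrFun (congrFun h1 j) (Fin.last n)
      rw [mul_apply, diagonal_mul] at h2
      simp only [Matrix.sum_apply, Matrix.smul_apply, smul_eq_mul, hcol, mul_zero,
        Finset.sum_const_zero] at h2
      exact (mul_eq_zero.1 h2.symm).resolve_right hj
    · have h1 : (∑ k : Fin (n + 1), c k • x ^ k.val) * A.val = A.val * diagonal p := by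
        rw [hsum, Units.inv_mul_cancel_right]
      have h2 := congrFun (congrFun h1 (Fin.last n)) j
      rw [mul_apply, mul_diagonal] at h2
      simp only [Matrix.sum_apply, Matrix.smul_apply, smul_eq_mul, hrow, zero_mul,
        Finset.sum_const_zero] at h2
      exact (mul_eq_zero.1 h2.symm).resolve_left hj
  -- Vandermonde: a polynomial of degree at most `n` vanishes at `n + 1` distinct points.
  exact congrFun (eq_zero_of_forall_index_sum_mul_pow_eq_zero hd hp0)

theorem conj_diagonal_mem_conjUpper {n : ℕ} (A : (Matrix (Fin n) (Fin n) ℂ)ˣ) (d : Fin n → ℂ) :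
    A.val * diagonal d * A⁻¹.val ∈ conjUpper A := by
  rw [mem_conjUpper, mul_assoc, mul_assoc, mul_assoc, Units.inv_mul_cancel_left, Units.inv_mul,
    mul_one]
  exact blockTriangular_diagonal d

/-- If the last row of `A` has a single nonzero entry, the stabilizer of the flag spanned by the
columns of `A` contains a matrix with linearly independent last rows and columns of powers. -/
theorem exists_linearIndependent_lastColRow {n : ℕ} (A : (Matrix (Fin (n + 1)) (Fin (n + 1)) ℂ)ˣ)
    (m : Fin (n + 1)) (hm : A.val (Fin.last n) m ≠ 0)
    (hr : ∀ j, j ≠ m → A.val (Fin.last n) j = 0) :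
    ∃ x ∈ conjUpper A, LinearIndependent ℂ (lastColRow x) := by
  set r := A.val (Fin.last n) with hr_def
  let c : Fin (n + 1) → ℂ := fun j => A⁻¹.val j (Fin.last n)
  have hcm : c m ≠ 0 := by
    intro h0
    have h1 := congrFun (congrFun A.mul_inv (Fin.last n)) (Fin.last n)
    rw [mul_apply, one_apply_eq, Finset.sum_eq_single m (fun j _ hj => by
      rw [show A.val (Fin.last n) j = 0 from hr j hj, zero_mul]) (by simp)] at h1
    rw [show A⁻¹.val m (Fin.last n) = 0 from h0, mul_zero] at h1
    exact zero_ne_one h1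
  -- `s` makes the last-column entries of the inverse equal to `1` for `j < m`; `t` adds column `m`
  -- to the later columns, making their last entries `r m`.
  let s : Fin (n + 1) → ℂ := fun j => if j < m then (c j - 1) / c m else 0
  let t : Fin (n + 1) → ℂ := fun j => if m < j then 1 else 0
  have hs : Pi.single m 1 ⬝ᵥ s = 0 := by simp [s]
  have ht : t ⬝ᵥ Pi.single m 1 = 0 := by simp [t]
  let B := A * unipotent s (Pi.single m 1) hs
  let C := B * unipotent (Pi.single m 1) t ht
  have hCA : conjUpper C ≤ conjUpper A := by
    refine (conjUpper_mul_unipotent_le B ht fun i j hij => ?_).trans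
      (conjUpper_mul_unipotent_le A hs fun i j hij => ?_)
    · by_cases him : i = m
      · subst him
        simp [t, hij.not_gt]
      · simp [him]
    · by_cases hjm : j = m
      · subst hjm
        simp [s, hij.not_gt]
      · simp [hjm]
  have hrB : ∀ j, B.val (Fin.last n) j = r j := by
    intro j
    have hrs : r ⬝ᵥ s = 0 := by
      refine Finset.sum_eq_zero fun j _ => ?_
      by_cases hj : j = m
      · simp [s, hj]
      · rw [hr j hj, zero_mul]
    have : B.val (Fin.last n) j = r j + (r ⬝ᵥ s) * (Pi.single m 1 : Fin (n + 1) → ℂ) j := by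
      simp only [B, unipotent, Units.val_mul, mul_add, mul_one, Matrix.add_apply, mul_vecMulVec,
        vecMulVec_apply]
      rfl
    rw [this, hrs, zero_mul, add_zero]
  have hrC : ∀ j, C.val (Fin.last n) j = r j + r m * t j := by
    intro j
    simp [C, unipotent, mul_add, Matrix.add_apply, mul_vecMulVec, vecMulVec_apply, hrB]
  have hcB : ∀ j, B⁻¹.val j (Fin.last n) = c j - s j * c m := by
    intro j
    have : B⁻¹.val = (1 - vecMulVec s (Pi.single m 1)) * A⁻¹.val := by
      rw [_root_.mul_inv_rev, Units.val_mul]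
      rfl
    rw [this]
    simp [sub_mul, Matrix.sub_apply, vecMulVec_mul, vecMulVec_apply, c]
  have hcC : ∀ j, j ≠ m → C⁻¹.val j (Fin.last n) = B⁻¹.val j (Fin.last n) := by
    intro j hj
    have : C⁻¹.val = (1 - vecMulVec (Pi.single m 1) t) * B⁻¹.val := by
      rw [_root_.mul_inv_rev, Units.val_mul]
      rfl
    rw [this]
    simp [sub_mul, Matrix.sub_apply, vecMulVec_mul, vecMulVec_apply, hj]
  refine ⟨_, hCA (conj_diagonal_mem_conjUpper C fun j => (j.val : ℂ)),
    linearIndependent_lastColRow_of_diagonal C _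
      (fun i j hij => Fin.ext (Nat.cast_injective hij)) fun j => ?_⟩
  rcases lt_trichotomy j m with hj | rfl | hj
  · left
    rw [hcC j hj.ne, hcB]
    simp only [s, hj, if_true, div_mul_cancel₀ _ hcm]
    simp
  · right
    simpa [hrC, t] using hm
  · right
    simpa [hrC, t, hj, hr j hj.ne'] using hm

/-- If the last row of `A` has a single nonzero entry, the corners of the matrices stabilizing the
flag spanned by the columns of `A` include a full flag stabilizer of `ℂ ^ n`. -/
theorem exists_corner_eq {n : ℕ} (A : (Matrix (Fin (n + 1)) (Fin (n + 1)) ℂ)ˣ)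
    (m : Fin (n + 1)) (hr : ∀ j, j ≠ m → A.val (Fin.last n) j = 0) :
    ∃ B : (Matrix (Fin n) (Fin n) ℂ)ˣ, ∀ y ∈ conjUpper B, ∃ x ∈ conjUpper A,
      corner n n.le_succ x = y := by
  -- `J` inserts a zero coordinate at `m`, `P` one at the end. Since the other columns of `A` lie in
  -- `ℂ ^ n`, `P * B₀ = A * J`.
  let J : Matrix (Fin (n + 1)) (Fin n) ℂ := (1 : Matrix (Fin (n + 1)) _ ℂ).submatrix id m.succAbove
  let P : Matrix (Fin (n + 1)) (Fin n) ℂ := (1 : Matrix (Fin (n + 1)) _ ℂ).submatrix id Fin.castSucc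
  let B₀ : Matrix (Fin n) (Fin n) ℂ := A.val.submatrix Fin.castSucc m.succAbove
  have hJJ : Jᵀ * J = 1 := by
    ext i j
    simp [J, mul_apply, one_apply]
  have hPP : Pᵀ * P = 1 := by
    ext i j
    simp [P, mul_apply, one_apply]
  have hPB : P * B₀ = A.val * J := by
    have hAJ : A.val * J = A.val.submatrix id m.succAbove := by
      ext i j
      simp [J, mul_apply, one_apply]
    rw [hAJ]
    ext i j
    refine Fin.lastCases ?_ (fun i => ?_) i
    · simp [P, mul_apply, one_apply, hr _ (Fin.succAbove_ne m j), (Fin.castSucc_lt_last _).ne']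
    · simp [P, B₀, mul_apply, one_apply]
  have hinv : (Jᵀ * A⁻¹.val * P) * B₀ = 1 := by
    rw [Matrix.mul_assoc, hPB, Matrix.mul_assoc, ← Matrix.mul_assoc A⁻¹.val, Units.inv_mul,
      Matrix.one_mul, hJJ]
  let B : (Matrix (Fin n) (Fin n) ℂ)ˣ :=
    ⟨B₀, Jᵀ * A⁻¹.val * P, mul_eq_one_comm.1 hinv, hinv⟩
  refine ⟨B, fun y hy => ?_⟩
  rw [mem_conjUpper] at hy
  have hAP : A⁻¹.val * P = J * B⁻¹.val := by
    have h1 : A⁻¹.val * P * B.val = J := by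
      rw [Matrix.mul_assoc, show P * B.val = A.val * J from hPB, ← Matrix.mul_assoc, Units.inv_mul,
        Matrix.one_mul]
    rw [← h1, Matrix.mul_assoc, Units.mul_inv, Matrix.mul_one]
  set T := B⁻¹.val * y * B.val with hT
  -- The lift kills column `m` of `A` and acts by `T` on the others.
  refine ⟨A.val * (J * T * Jᵀ) * A⁻¹.val, ?_, ?_⟩
  · rw [mem_conjUpper, mul_assoc, mul_assoc, mul_assoc, Units.inv_mul_cancel_left, Units.inv_mul,
      mul_one]
    have hJm : ∀ k, J m k = 0 := fun k => by simp [J, (Fin.succAbove_ne m k).symm]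
    have hJs : ∀ i k, J (m.succAbove i) k = (1 : Matrix (Fin n) (Fin n) ℂ) i k := fun i k => by
      simp [J, one_apply]
    intro i j hij
    simp only [mul_apply, transpose_apply]
    rcases Fin.eq_self_or_eq_succAbove m i with rfl | ⟨i, rfl⟩
    · simp [hJm]
    rcases Fin.eq_self_or_eq_succAbove m j with rfl | ⟨j, rfl⟩
    · simp [hJm]
    have hij' : T i j = 0 := hy (Fin.succAbove_lt_succAbove_iff.1 hij)
    simpa [hJs, one_apply] using hij'
  · have hcorner : ∀ x : Matrix (Fin (n + 1)) (Fin (n + 1)) ℂ,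
        corner n n.le_succ x = Pᵀ * (x * P) := by
      intro x
      ext i j
      simp [P, mul_apply, one_apply, corner]
      rfl
    rw [hcorner, Matrix.mul_assoc, hAP]
    calc Pᵀ * (A.val * (J * T * Jᵀ) * (J * B⁻¹.val))
        = Pᵀ * (A.val * J) * T * (Jᵀ * J) * B⁻¹.val := by simp only [Matrix.mul_assoc]
      _ = Pᵀ * P * (B.val * T * B⁻¹.val) := by
        rw [hJJ, ← hPB, Matrix.mul_one]
        simp only [Matrix.mul_assoc]
        rfl
      _ = y := by
        rw [hPP, Matrix.one_mul, hT]
        simp only [mul_assoc, Units.mul_inv_cancel_left, Units.mul_inv, mul_one]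

/-! ### The induction -/

theorem exists_isStronglyRegular_mem_conjUpper (n : ℕ) (A : (Matrix (Fin n) (Fin n) ℂ)ˣ) :
    ∃ x ∈ conjUpper A, IsStronglyRegular x := by
  induction n with
  | zero =>
    exact ⟨0, zero_mem _, linearIndependent_empty_type⟩
  | succ n ih =>
    obtain ⟨B, m, hBA, hm, hr⟩ := exists_conjUpper_le_and_last_row A
    obtain ⟨C, hC⟩ := exists_corner_eq B m hr
    obtain ⟨y, hy, hyr⟩ := ih C
    obtain ⟨a, ha, rfl⟩ := hC y hy
    obtain ⟨d, hd, hdi⟩ := exists_linearIndependent_lastColRow B m hm hr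
    let x : ℂ → Matrix (Fin (n + 1)) (Fin (n + 1)) ℂ := fun t => a + t • (d - a)
    have hx0 : x 0 = a := by simp [x]
    have hx1 : x 1 = d := by simp [x]
    obtain ⟨g, hg, hg0, hgx⟩ := exists_differentiable_detecting_linearIndependent
      (fun t => gzDiff (corner n n.le_succ (x t)))
      (fun φ p => by
        -- By reflexivity, a functional on the dual is evaluation at a matrix.
        obtain ⟨y, rfl⟩ := (evalEquiv ℂ _).surjective φ
        exact differentiable_gzDiff_line (corner n n.le_succ a) (corner n n.le_succ (d - a)) p y)
      0 (by rw [hx0]; exact isStronglyRegular_iff.1 hyr)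
    obtain ⟨h, hh, hh1, hhx⟩ := exists_differentiable_detecting_linearIndependent
      (fun t => lastColRow (x t))
      (fun φ k => by
        let ψ : Matrix (Fin (n + 1)) (Fin (n + 1)) ℂ →ₗ[ℂ]
            (Fin (n + 1) → ℂ) × (Fin (n + 1) → ℂ) :=
          { toFun := fun y => (y.col (Fin.last n), y.row (Fin.last n))
            map_add' := fun _ _ => rfl
            map_smul' := fun _ _ => rfl }
        exact differentiable_apply_pow_line a (d - a) k.val (φ ∘ₗ ψ))
      1 (by rw [hx1]; exact hdi)
    obtain ⟨t, ht1, ht2⟩ := exists_ne_zero_and_ne_zero hg hh hg0 hh1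
    exact ⟨x t, hBA (add_mem ha (SMulMemClass.smul_mem t (sub_mem hd ha))),
      isStronglyRegular_of_corner (isStronglyRegular_iff.2 (hgx t ht1)) (hhx t ht2)⟩

end GelfandZeitlin

theorem theorem3p12 (n : ℕ) (b : LieSubalgebra ℂ (Matrix (Fin n) (Fin n) ℂ))
    (hb : GelfandZeitlin.IsBorel b) :
    ∃ x : Matrix (Fin n) (Fin n) ℂ, x ∈ b ∧ GelfandZeitlin.IsStronglyRegular x := by
  obtain ⟨A, rfl⟩ := hb.exists_eq_conjUpper
  exact GelfandZeitlin.exists_isStronglyRegular_mem_conjUpper n A
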